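/- Let $V$, $E$, $F$ be real normed vector spaces (for instance finite-dimensional ones), let $M\subseteq V$ be open (for instance $M=V$), and let $S : V\to \mathrm{Hom}(E,F)$ be a continuous linear map, regarded as a constant $\mathrm{Hom}(E,F)$-valued one-form on $M$. Let $A^i=\Lambda^i\otimes E$ and $B^i=\Lambda^i\otimes F$ be the spaces of smooth $E$-valued and $F$-valued differential $i$-forms on $M$ ($i\ge 0$), with the exterior derivative $\mathrm d$, and let $S^i:A^i\to B^{i+1}$ be $u\mapsto S\wedge u$, that is $(S\wedge u)(v_0,\dots,v_i)=\sum_k(-1)^kS(v_k)\,u(v_0,\dots,\widehat{v_k},\dots,v_i)$; it satisfies $\mathrm dS^i=-S^{i+1}\mathrm d$. Let $Z_S^\bullet$ be the mapping cone, $Z_S^i=B^i\oplus A^i$, with differential $\mathrm d_S=\begin{bmatrix}\mathrm d&S^i\\0&\mathrm d\end{bmatrix}$, and let $Z_0^\bullet$ be the same with $S=0$. Let $R:V\to\mathrm{Hom}(E,F)$ be the contraction of $S$ by the identity vector field, $R(x)=S(x)$, and put $$Q(x)=\begin{bmatrix}I_F&-R(x)\\0&I_E\end{bmatrix},\qquad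 Q(x)^{-1}=\begin{bmatrix}I_F&R(x)\\0&I_E\end{bmatrix}.$$ Then: 1. $\mathrm DR=S$. The differential $\mathrm d_S$ is the covariant exterior derivative $u\mapsto \mathrm du+A_S\wedge u$ of the connection one-form $A_S=\begin{bmatrix}0&S\\0&0\end{bmatrix}$ on forms with values in $F\oplus E$, and $A_S$ is the gauge transform $Q\,A\,Q^{-1}-(\mathrm DQ)Q^{-1}$ of the trivial connection one-form $A=0$ by $Q$. 2. The map $u\mapsto Qu$ (pointwise action of $Q(x)$ on the values of the form) is an isomorphism of complexes $Z_0^\bullet\to Z_S^\bullet$, with inverse $u\mapsto Q^{-1}u$. In particular it induces isomorphisms $\mathcal H^i(Z_0^\bullet)\cong\mathcal H^i(Z_S^\bullet)$ for all $i$. 3. The map $\mathcal H^i(A^\bullet)\to\mathcal H^{i+1}(B^\bullet)$, $[u]\mapsto[S\wedge u]$, induced by $S$ on cohomology is zero for every $i\ge 0$. -/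

import Mathlib

open CategoryTheory
open scoped ContDiff

universe u

noncomputable section

namespace TwistedDeRham

section Forms

variable {V E F G : Type u}
  [NormedAddCommGroup V] [NormedSpace ℝ V] [NormedAddCommGroup E] [NormedSpace ℝ E]
  [NormedAddCommGroup F] [NormedSpace ℝ F] [NormedAddCommGroup G] [NormedSpace ℝ G]

/-- The space `Λ^i ⊗ E` of smooth `E`-valued differential `i`-forms on the open set `M` of `V`.
A form on `M` is represented by its extension by zero to `V`, so that two elements are equal if and
only if they agree on `M`; smoothness is required on `M` only. -/
def Form (M : TopologicalSpace.Opens V) (E : Type u) [NormedAddCommGroup E] [NormedSpace ℝ E]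
    (i : ℕ) : Submodule ℝ (V → V [⋀^Fin i]→L[ℝ] E) where
  carrier := {w | ContDiffOn ℝ ∞ w M ∧ ∀ x ∉ M, w x = 0}
  add_mem' := fun ha hb => ⟨ha.1.add hb.1, fun x hx => by simp [ha.2 x hx, hb.2 x hx]⟩
  zero_mem' := ⟨contDiffOn_const, fun _ _ => rfl⟩
  smul_mem' := fun c _ ha => ⟨ha.1.const_smul c, fun x hx => by simp [ha.2 x hx]⟩

variable {M : TopologicalSpace.Opens V} {i : ℕ}

theorem Form.differentiableAt (w : Form M E i) {x : V} (hx : x ∈ M) :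
    DifferentiableAt ℝ w.1 x :=
  (w.2.1.contDiffAt (M.isOpen.mem_nhds hx)).differentiableAt (by simp)

theorem Form.ext_on {w η : Form M E i} (h : ∀ x ∈ M, w.1 x = η.1 x) : w = η := by
  refine Subtype.ext (funext fun x => ?_)
  by_cases hx : x ∈ M
  · exact h x hx
  · rw [w.2.2 x hx, η.2.2 x hx]

open Classical in
/-- The exterior derivative `d` of `E`-valued forms on `M`. -/
def extD (M : TopologicalSpace.Opens V) (E : Type u) [NormedAddCommGroup E] [NormedSpace ℝ E]
    (i : ℕ) : Form M E i →ₗ[ℝ] Form M E (i + 1) where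
  toFun w := ⟨fun x => if x ∈ M then extDeriv w.1 x else 0, by
    constructor
    · have h : ContDiffOn ℝ ∞ (extDeriv w.1) M :=
        (ContinuousAlternatingMap.alternatizeUncurryFinCLM ℝ V E).contDiff.comp_contDiffOn
          (w.2.1.fderiv_of_isOpen M.isOpen (by simp))
      exact h.congr fun x hx => if_pos hx
    · intro x hx
      exact if_neg hx⟩
  map_add' w η := by
    refine Form.ext_on fun x hx => ?_
    simp [hx, extDeriv_add (Form.differentiableAt w hx) (Form.differentiableAt η hx)]
  map_smul' c w := by
    refine Form.ext_on fun x hx => ?_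
    simp [hx, extDeriv_smul]

theorem extD_apply (w : Form M E i) {x : V} (hx : x ∈ M) :
    (extD M E i w).1 x = extDeriv w.1 x := by
  simp [extD, hx]

theorem extD_extD (w : Form M E i) : extD M E (i + 1) (extD M E i w) = 0 := by
  refine Form.ext_on fun x hx => ?_
  have hev : (extD M E i w).1 =ᶠ[nhds x] extDeriv w.1 :=
    Filter.eventually_of_mem (M.isOpen.mem_nhds hx) fun y hy => extD_apply w hy
  rw [extD_apply _ hx, hev.extDeriv_eq,
    extDeriv_extDeriv_apply (w.2.1.contDiffAt (M.isOpen.mem_nhds hx))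
      (by rw [minSmoothness_of_isRCLikeNormedField]; exact WithTop.coe_le_coe.2 le_top)]
  rfl

/-- The wedge product `a ∧ w` of a `Hom(E, F)`-valued covector `a` with an `E`-valued alternating
form `w`, evaluating endomorphisms on vectors:
`(a ∧ w)(v₀, …, vᵢ) = ∑ₖ (-1)ᵏ a(vₖ) (w(v₀, …, v̂ₖ, …, vᵢ))`. -/
def wedge (i : ℕ) (a : V →L[ℝ] E →L[ℝ] F) : (V [⋀^Fin i]→L[ℝ] E) →L[ℝ] (V [⋀^Fin (i + 1)]→L[ℝ] F) :=
  ContinuousAlternatingMap.alternatizeUncurryFinCLM ℝ V F ∘L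
    (ContinuousLinearMap.compContinuousAlternatingMapCLM ℝ V E F (Fin i) ∘L a).flip

theorem wedge_apply (a : V →L[ℝ] E →L[ℝ] F) (w : V [⋀^Fin i]→L[ℝ] E) (v : Fin (i + 1) → V) :
    wedge i a w v = ∑ k : Fin (i + 1), (-1) ^ (k : ℕ) • a (v k) (w (k.removeNth v)) := by
  simp [wedge, ContinuousAlternatingMap.alternatizeUncurryFin_apply]

/-- The map `S^i : A^i → B^{i+1}`, `u ↦ S ∧ u`, for a constant `S ∈ Λ¹ ⊗ Hom(E, F)`. -/
def wedgeS (M : TopologicalSpace.Opens V) (S : V →L[ℝ] E →L[ℝ] F) (i : ℕ) :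
    Form M E i →ₗ[ℝ] Form M F (i + 1) where
  toFun w := ⟨fun x => wedge i S (w.1 x),
    (wedge i S).contDiff.comp_contDiffOn w.2.1, fun x hx => by simp [w.2.2 x hx]⟩
  map_add' w η := Form.ext_on fun x _ => by simp
  map_smul' c w := Form.ext_on fun x _ => by simp

theorem extD_wedgeS (S : V →L[ℝ] E →L[ℝ] F) (w : Form M E i) :
    extD M F (i + 1) (wedgeS M S i w) = -wedgeS M S (i + 1) (extD M E i w) := by
  rw [eq_neg_iff_add_eq_zero]
  refine Form.ext_on fun x hx => ?_
  have h1 : (extD M F (i + 1) (wedgeS M S i w)).1 x =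
      ContinuousAlternatingMap.alternatizeUncurryFin ((wedge i S) ∘L fderiv ℝ w.1 x) := by
    rw [extD_apply _ hx, extDeriv]
    congr 1
    exact ((wedge i S).hasFDerivAt.comp x (Form.differentiableAt w hx).hasFDerivAt).fderiv
  have h2 : (wedgeS M S (i + 1) (extD M E i w)).1 x = wedge (i + 1) S (extDeriv w.1 x) := by
    rw [← extD_apply _ hx]; rfl
  let C := ContinuousLinearMap.compContinuousAlternatingMapCLM ℝ V E F (Fin i) ∘L S
  let f : V →L[ℝ] V →L[ℝ] V [⋀^Fin i]→L[ℝ] F :=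
    (ContinuousLinearMap.compL ℝ V (V [⋀^Fin i]→L[ℝ] E) (V [⋀^Fin i]→L[ℝ] F)).flip
      (fderiv ℝ w.1 x) ∘L C
  have h3 := ContinuousAlternatingMap.alternatizeUncurryFin_alternatizeUncurryFinCLM_comp_of_symmetric
    (f := f + f.flip) (fun x y => by simp [add_comm])
  have h4 : wedge (i + 1) S (extDeriv w.1 x) = ContinuousAlternatingMap.alternatizeUncurryFin
      (ContinuousAlternatingMap.alternatizeUncurryFinCLM ℝ V F ∘L f) := by
    ext v
    rw [wedge_apply, ContinuousAlternatingMap.alternatizeUncurryFin_apply]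
    simp [extDeriv, ContinuousAlternatingMap.alternatizeUncurryFin_apply, f, C]
  have h5 : (wedge i S) ∘L fderiv ℝ w.1 x =
      ContinuousAlternatingMap.alternatizeUncurryFinCLM ℝ V F ∘L f.flip := by
    ext v w
    simp [wedge, ContinuousAlternatingMap.alternatizeUncurryFin_apply, f, C]
  change (extD M F (i + 1) (wedgeS M S i w)).1 x + (wedgeS M S (i + 1) (extD M E i w)).1 x = 0
  rw [h1, h2, h4, h5, ← ContinuousAlternatingMap.alternatizeUncurryFin_add,
    ← ContinuousLinearMap.comp_add, add_comm f.flip, h3]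

/-- The differential `d_S = [[d, S], [0, d]]` of the mapping cone, acting on `B^i ⊕ A^i`. -/
def coneD (M : TopologicalSpace.Opens V) (S : V →L[ℝ] E →L[ℝ] F) (i : ℕ) :
    (Form M F i × Form M E i) →ₗ[ℝ] (Form M F (i + 1) × Form M E (i + 1)) where
  toFun z := (extD M F i z.1 + wedgeS M S i z.2, extD M E i z.2)
  map_add' y z := by
    simp only [Prod.fst_add, Prod.snd_add, map_add, Prod.mk_add_mk, Prod.mk.injEq, and_true]
    abel
  map_smul' c z := by simp

theorem coneD_coneD (S : V →L[ℝ] E →L[ℝ] F) (z : Form M F i × Form M E i) :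
    coneD M S (i + 1) (coneD M S i z) = 0 := by
  simp [coneD, extD_extD, extD_wedgeS]

/-- The de Rham complex `Λ^• ⊗ E` on `M`. -/
def deRham (M : TopologicalSpace.Opens V) (E : Type u) [NormedAddCommGroup E] [NormedSpace ℝ E] :
    CochainComplex (ModuleCat.{u} ℝ) ℕ :=
  CochainComplex.of (fun i => ModuleCat.of ℝ (Form M E i)) (fun i => ModuleCat.ofHom (extD M E i))
    (fun _ => by ext1; exact LinearMap.ext extD_extD)

theorem deRham_d (M : TopologicalSpace.Opens V) (i : ℕ) :
    (deRham M E).d i (i + 1) = ModuleCat.ofHom (extD M E i) :=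
  CochainComplex.of_d (fun i => ModuleCat.of ℝ (Form M E i)) (fun i => ModuleCat.ofHom (extD M E i)) i

/-- The mapping cone `Z_S^•`, `Z_S^i = B^i ⊕ A^i`, with differential `d_S`. -/
def cone (M : TopologicalSpace.Opens V) (S : V →L[ℝ] E →L[ℝ] F) :
    CochainComplex (ModuleCat.{u} ℝ) ℕ :=
  CochainComplex.of (fun i => ModuleCat.of ℝ (Form M F i × Form M E i))
    (fun i => ModuleCat.ofHom (coneD M S i))
    (fun _ => by ext1; exact LinearMap.ext (coneD_coneD S))

/-- The identification `(Λ^i ⊗ F) ⊕ (Λ^i ⊗ E) = Λ^i ⊗ (F ⊕ E)`. -/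
def joined (z : Form M F i × Form M E i) : V → V [⋀^Fin i]→L[ℝ] (F × E) :=
  fun x => (z.1.1 x).prod (z.2.1 x)

end Forms

section Gauge

variable {V E F G : Type u}
  [NormedAddCommGroup V] [NormedSpace ℝ V] [NormedAddCommGroup E] [NormedSpace ℝ E]
  [NormedAddCommGroup F] [NormedSpace ℝ F] [NormedAddCommGroup G] [NormedSpace ℝ G]

/-- The covariant exterior derivative `d_A u = du + A ∧ u` of the connection one-form `A`. -/
def covExtDeriv {i : ℕ} (A : V → V →L[ℝ] G →L[ℝ] G) (w : V → V [⋀^Fin i]→L[ℝ] G) (x : V) :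
    V [⋀^Fin (i + 1)]→L[ℝ] G :=
  extDeriv w x + wedge i (A x) (w x)

/-- The gauge transform `Q A Q⁻¹ - (DQ) Q⁻¹` of the connection one-form `A`, evaluated at the point
`x` on the tangent vector `v`. -/
def gaugeTransform (Q : V → G ≃L[ℝ] G) (A : V → V →L[ℝ] G →L[ℝ] G) (x v : V) : G →L[ℝ] G :=
  (Q x : G →L[ℝ] G) ∘L A x v ∘L ((Q x).symm : G →L[ℝ] G) -
    fderiv ℝ (fun y => (Q y : G →L[ℝ] G)) x v ∘L ((Q x).symm : G →L[ℝ] G)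

/-- The block matrix `[[0, T], [0, 0]]` acting on `F ⊕ E`. -/
def upper (T : E →L[ℝ] F) : F × E →L[ℝ] F × E :=
  ContinuousLinearMap.inl ℝ F E ∘L T ∘L ContinuousLinearMap.snd ℝ F E

/-- The constant connection one-form `[[0, S], [0, 0]]`. -/
def connectionForm (S : V →L[ℝ] E →L[ℝ] F) (_x : V) : V →L[ℝ] (F × E →L[ℝ] F × E) :=
  LinearMap.mkContinuous
    { toFun := fun v => upper (S v)
      map_add' := fun v w => by ext <;> simp [upper]
      map_smul' := fun c v => by ext <;> simp [upper] } ‖S‖ (fun v => by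
        refine ContinuousLinearMap.opNorm_le_bound _ (by positivity) fun z => ?_
        have h1 : ‖S v z.2‖ ≤ ‖S‖ * ‖v‖ * ‖z.2‖ := S.le_opNorm₂ v z.2
        have h2 : ‖z.2‖ ≤ ‖z‖ := norm_snd_le z
        have h3 : ‖S‖ * ‖v‖ * ‖z.2‖ ≤ ‖S‖ * ‖v‖ * ‖z‖ := by gcongr
        simpa [upper, Prod.norm_def] using h1.trans h3)

/-- The block matrix `[[I, R(x)], [0, I]]` acting on `F ⊕ E`, with inverse `[[I, -R(x)], [0, I]]`. -/
def unipotent (R : V → E →L[ℝ] F) (x : V) : (F × E) ≃L[ℝ] (F × E) :=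
  ContinuousLinearEquiv.equivOfInverse
    (ContinuousLinearMap.id ℝ (F × E) + upper (R x))
    (ContinuousLinearMap.id ℝ (F × E) - upper (R x))
    (fun z => by simp [upper]) (fun z => by simp [upper])

/-- The contraction `x ↦ w(x)(ξ(x))` of a one-form by a vector field. -/
def contract {W : Type u} [NormedAddCommGroup W] [NormedSpace ℝ W]
    (w : V → V →L[ℝ] W) (ξ : V → V) (x : V) : W :=
  w x (ξ x)

end Gauge

section Cohomology

/-- The map on cocycles `ker d^i ⊆ K^i → ker d^{i+1} ⊆ L^{i+1}`, `u ↦ f u`, given by a family of maps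
`f i : K^i → L^{i+1}` that anticommutes with the differentials. -/
def inducedOnCocycles {K L : CochainComplex (ModuleCat.{u} ℝ) ℕ}
    (f : ∀ i, K.X i ⟶ L.X (i + 1))
    (hf : ∀ i, f i ≫ L.d (i + 1) (i + 2) = -(K.d i (i + 1) ≫ f (i + 1))) (i : ℕ) :
    K.cycles i ⟶ L.cycles (i + 1) :=
  L.liftCycles (K.iCycles i ≫ f i) (i + 2) (by simp) (by rw [Category.assoc, hf]; simp)

theorem toCycles_inducedOnCocycles {K L : CochainComplex (ModuleCat.{u} ℝ) ℕ}
    (f : ∀ i, K.X i ⟶ L.X (i + 1))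
    (hf : ∀ i, f i ≫ L.d (i + 1) (i + 2) = -(K.d i (i + 1) ≫ f (i + 1))) (i j : ℕ) :
    K.toCycles j i ≫ inducedOnCocycles f hf i ≫ L.homologyπ (i + 1) = 0 := by
  by_cases h : (ComplexShape.up ℕ).Rel j i
  · obtain rfl : j + 1 = i := h
    rw [← Category.assoc, inducedOnCocycles, HomologicalComplex.comp_liftCycles]
    refine L.liftCycles_homologyπ_eq_zero_of_boundary _ _ _ (i' := j + 1) (-f j) ?_
    rw [← Category.assoc, K.toCycles_i, Preadditive.neg_comp, hf, neg_neg]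
  · rw [K.toCycles_eq_zero h, Limits.zero_comp]

/-- The map `H^i(K) → H^{i+1}(L)`, `[u] ↦ [f u]`, induced on cohomology by a family of maps
`f i : K^i → L^{i+1}` that anticommutes with the differentials. -/
def inducedOnCohomology {K L : CochainComplex (ModuleCat.{u} ℝ) ℕ}
    (f : ∀ i, K.X i ⟶ L.X (i + 1))
    (hf : ∀ i, f i ≫ L.d (i + 1) (i + 2) = -(K.d i (i + 1) ≫ f (i + 1))) (i : ℕ) :
    K.homology i ⟶ L.homology (i + 1) :=
  (K.sc i).descHomology (inducedOnCocycles f hf i ≫ L.homologyπ (i + 1))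
    (toCycles_inducedOnCocycles f hf i _)

variable {V E F : Type u}
  [NormedAddCommGroup V] [NormedSpace ℝ V] [NormedAddCommGroup E] [NormedSpace ℝ E]
  [NormedAddCommGroup F] [NormedSpace ℝ F]

/-- The map `H^i(A^•) → H^{i+1}(B^•)`, `[u] ↦ [S ∧ u]`, induced by `S` on cohomology. -/
def cohomologyS (M : TopologicalSpace.Opens V) (S : V →L[ℝ] E →L[ℝ] F) (i : ℕ) :
    (deRham M E).homology i ⟶ (deRham M F).homology (i + 1) :=
  inducedOnCohomology (K := deRham M E) (L := deRham M F)
    (fun i => ModuleCat.ofHom (wedgeS M S i))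
    (fun i => by
      rw [deRham_d, deRham_d]
      ext1
      exact LinearMap.ext (extD_wedgeS S)) i

end Cohomology

end TwistedDeRham

end

/-!
The covariant exterior derivative is gauge covariant: if `B` is the gauge transform of `A` by `Q`,
then `d_B (Q u) = Q (d_A u)`, by the Leibniz rule `d(Q u) = DQ ∧ u + Q du`. Now `d_S` is the
covariant exterior derivative of `[[0, S], [0, 0]]`, and for any primitive `R` of `S` this
connection is the gauge transform of the trivial one by `[[I, -R], [0, I]]`. Hence this matrix
intertwines `d_0` and `d_S`. For `R` in place of `Q`, the Leibniz rule reads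
`S ∧ u = d(R u) - R du`, which is a null-homotopy of `u ↦ S ∧ u`.
-/

noncomputable section

namespace TwistedDeRham

section ExteriorCalculus

theorem extDeriv_prod {𝕜 V E F : Type*} [NontriviallyNormedField 𝕜]
    [NormedAddCommGroup V] [NormedSpace 𝕜 V] [NormedAddCommGroup E] [NormedSpace 𝕜 E]
    [NormedAddCommGroup F] [NormedSpace 𝕜 F] {i : ℕ} {u : V → V [⋀^Fin i]→L[𝕜] E}
    {w : V → V [⋀^Fin i]→L[𝕜] F} {x : V}
    (hu : DifferentiableAt 𝕜 u x) (hw : DifferentiableAt 𝕜 w x) :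
    extDeriv (fun y => (u y).prod (w y)) x = (extDeriv u x).prod (extDeriv w x) := by
  let e := (ContinuousAlternatingMap.prodLIE 𝕜 V E F (ι := Fin i)).toContinuousLinearEquiv
  have hprod : HasFDerivAt (fun y => (u y).prod (w y))
      (e ∘L (fderiv 𝕜 u x).prod (fderiv 𝕜 w x)) x :=
    e.hasFDerivAt.comp x (hu.hasFDerivAt.prodMk hw.hasFDerivAt)
  ext v <;>
    simp [extDeriv, hprod.fderiv, ContinuousAlternatingMap.alternatizeUncurryFin_apply,
      Prod.fst_sum, Prod.snd_sum, e]

variable {V E F G : Type u}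
  [NormedAddCommGroup V] [NormedSpace ℝ V] [NormedAddCommGroup E] [NormedSpace ℝ E]
  [NormedAddCommGroup F] [NormedSpace ℝ F] [NormedAddCommGroup G] [NormedSpace ℝ G]
  {i : ℕ} {x : V}

theorem extDeriv_compContinuousAlternatingMap {T : V → E →L[ℝ] F} {w : V → V [⋀^Fin i]→L[ℝ] E}
    (hT : DifferentiableAt ℝ T x) (hw : DifferentiableAt ℝ w x) :
    extDeriv (fun y => (T y).compContinuousAlternatingMap (w y)) x =
      wedge i (fderiv ℝ T x) (w x) + (T x).compContinuousAlternatingMap (extDeriv w x) := by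
  let c := ContinuousLinearMap.compContinuousAlternatingMapCLM ℝ V E F (Fin i)
  have hTw : HasFDerivAt (fun y => (T y).compContinuousAlternatingMap (w y))
      (c (T x) ∘L fderiv ℝ w x + (c ∘L fderiv ℝ T x).flip (w x)) x :=
    HasFDerivAt.clm_apply (c := fun y => c (T y)) (c.hasFDerivAt.comp x hT.hasFDerivAt)
      hw.hasFDerivAt
  ext v
  simp [extDeriv, hTw.fderiv, wedge_apply, ContinuousAlternatingMap.alternatizeUncurryFin_apply, c,
    add_comm]

theorem covExtDeriv_gaugeTransform {Q : V → G ≃L[ℝ] G} {A B : V → V →L[ℝ] G →L[ℝ] G}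
    {w : V → V [⋀^Fin i]→L[ℝ] G} (hQ : DifferentiableAt ℝ (fun y => (Q y : G →L[ℝ] G)) x)
    (hw : DifferentiableAt ℝ w x) (hB : ∀ v, gaugeTransform Q A x v = B x v) :
    covExtDeriv B (fun y => (Q y : G →L[ℝ] G).compContinuousAlternatingMap (w y)) x =
      (Q x : G →L[ℝ] G).compContinuousAlternatingMap (covExtDeriv A w x) := by
  let DQ := fderiv ℝ (fun y => (Q y : G →L[ℝ] G)) x
  have hBQ : ∀ v g, B x v (Q x g) = Q x (A x v g) - DQ v g := fun v g => by
    simp [← hB, gaugeTransform, DQ]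
  have hwedge : wedge i (B x) ((Q x : G →L[ℝ] G).compContinuousAlternatingMap (w x)) =
      (Q x : G →L[ℝ] G).compContinuousAlternatingMap (wedge i (A x) (w x)) - wedge i DQ (w x) := by
    ext v
    simp [wedge_apply, hBQ, smul_sub]
  rw [covExtDeriv, covExtDeriv, extDeriv_compContinuousAlternatingMap hQ hw, hwedge]
  ext v
  simp only [ContinuousAlternatingMap.add_apply, ContinuousAlternatingMap.sub_apply,
    ContinuousLinearMap.compContinuousAlternatingMap_coe, Function.comp_apply, map_add, DQ]
  abel

end ExteriorCalculus

section UnipotentGauge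

variable {V E F : Type u}
  [NormedAddCommGroup E] [NormedSpace ℝ E] [NormedAddCommGroup F] [NormedSpace ℝ F]

theorem unipotent_apply (R : V → E →L[ℝ] F) (x : V) (z : F × E) :
    unipotent R x z = (z.1 + R x z.2, z.2) := by
  ext <;> simp [unipotent, upper]

theorem unipotent_symm (R : V → E →L[ℝ] F) (x : V) :
    (unipotent R x).symm = unipotent (-R) x := by
  ext z <;> simp [unipotent, upper, sub_eq_add_neg]

variable [NormedAddCommGroup V] [NormedSpace ℝ V]

@[simp]
theorem connectionForm_apply (T : V →L[ℝ] E →L[ℝ] F) (x v : V) :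
    connectionForm T x v = upper (T v) :=
  rfl

theorem connectionForm_zero : connectionForm (0 : V →L[ℝ] E →L[ℝ] F) = 0 := by
  ext x v z <;> simp [upper]

variable {R : V → E →L[ℝ] F} {R' : V →L[ℝ] E →L[ℝ] F} {x : V}

theorem hasFDerivAt_unipotent (hR : HasFDerivAt R R' x) :
    HasFDerivAt (fun y => (unipotent R y : F × E →L[ℝ] F × E)) (connectionForm R' x) x := by
  have hupper := (hasFDerivAt_const (ContinuousLinearMap.inl ℝ F E) x).clm_comp
    (hR.clm_comp (hasFDerivAt_const (ContinuousLinearMap.snd ℝ F E) x))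
  refine (hupper.const_add (ContinuousLinearMap.id ℝ (F × E))).congr_fderiv ?_
  ext v z <;> simp [upper]

theorem gaugeTransform_unipotent_connectionForm (T : V →L[ℝ] E →L[ℝ] F)
    (hR : HasFDerivAt R R' x) (v : V) :
    gaugeTransform (unipotent R) (connectionForm T) x v = connectionForm (T - R') x v := by
  rw [gaugeTransform, (hasFDerivAt_unipotent hR).fderiv, unipotent_symm]
  ext z <;> simp [unipotent_apply, upper]

end UnipotentGauge

section ConeIsomorphism

variable {V E F : Type u}
  [NormedAddCommGroup V] [NormedSpace ℝ V] [NormedAddCommGroup E] [NormedSpace ℝ E]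
  [NormedAddCommGroup F] [NormedSpace ℝ F] {M : TopologicalSpace.Opens V} {i : ℕ}
  {R : V → E →L[ℝ] F}

theorem differentiableAt_joined (z : Form M F i × Form M E i) {x : V} (hx : x ∈ M) :
    DifferentiableAt ℝ (joined z) x :=
  (ContinuousAlternatingMap.prodLIE ℝ V F E
    (ι := Fin i)).toContinuousLinearEquiv.differentiableAt.comp x
    ((Form.differentiableAt z.1 hx).prodMk (Form.differentiableAt z.2 hx))

theorem joined_ext_on {y z : Form M F i × Form M E i} (h : ∀ x ∈ M, joined y x = joined z x) :
    y = z := by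
  refine Prod.ext (Form.ext_on fun x hx => ?_) (Form.ext_on fun x hx => ?_) <;> ext v
  · exact congrArg (fun a => (a v).1) (h x hx)
  · exact congrArg (fun a => (a v).2) (h x hx)

theorem joined_coneD (S : V →L[ℝ] E →L[ℝ] F) (z : Form M F i × Form M E i) {x : V} (hx : x ∈ M) :
    joined (coneD M S i z) x = covExtDeriv (connectionForm S) (joined z) x := by
  have hfst : (coneD M S i z).1.1 x = extDeriv z.1.1 x + wedge i S (z.2.1 x) :=
    congrArg (· + wedge i S (z.2.1 x)) (extD_apply z.1 hx)
  have hsnd : (coneD M S i z).2.1 x = extDeriv z.2.1 x := extD_apply z.2 hx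
  have hd : extDeriv (joined z) x = (extDeriv z.1.1 x).prod (extDeriv z.2.1 x) :=
    extDeriv_prod (Form.differentiableAt z.1 hx) (Form.differentiableAt z.2 hx)
  rw [covExtDeriv, hd, joined, hfst, hsnd]
  ext v <;> simp [wedge_apply, upper, joined, Prod.fst_sum, Prod.snd_sum]

/-- The action `u ↦ R u` of a smooth `Hom(E, F)`-valued function `R` on `E`-valued forms, given by
applying `R x` to the values of the form at `x`. -/
def applyHom (R : V → E →L[ℝ] F) (hR : ContDiffOn ℝ ∞ R M) (i : ℕ) :
    Form M E i →ₗ[ℝ] Form M F i where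
  toFun w := ⟨fun x => (R x).compContinuousAlternatingMap (w.1 x),
    ContDiffOn.clm_apply (f := fun x =>
      ContinuousLinearMap.compContinuousAlternatingMapCLM ℝ V E F (Fin i) (R x))
      ((ContinuousLinearMap.contDiff _).comp_contDiffOn hR) w.2.1,
    fun x hx => by ext; simp [w.2.2 x hx]⟩
  map_add' w η := Form.ext_on fun x _ => by ext; simp
  map_smul' c w := Form.ext_on fun x _ => by ext; simp

theorem extD_applyHom {S : V →L[ℝ] E →L[ℝ] F} (hR : ContDiffOn ℝ ∞ R M)
    (hS : ∀ x ∈ M, fderiv ℝ R x = S) (w : Form M E i) :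
    extD M F i (applyHom R hR i w) = wedgeS M S i w + applyHom R hR (i + 1) (extD M E i w) := by
  refine Form.ext_on fun x hx => ?_
  have hRx : DifferentiableAt ℝ R x :=
    (hR.contDiffAt (M.isOpen.mem_nhds hx)).differentiableAt (by simp)
  calc (extD M F i (applyHom R hR i w)).1 x
      = wedge i (fderiv ℝ R x) (w.1 x) + (R x).compContinuousAlternatingMap (extDeriv w.1 x) :=
        (extD_apply _ hx).trans
          (extDeriv_compContinuousAlternatingMap hRx (Form.differentiableAt w hx))
    _ = wedge i S (w.1 x) + (R x).compContinuousAlternatingMap ((extD M E i w).1 x) := by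
        rw [hS x hx, extD_apply w hx]

/-- The action `(b, a) ↦ (b + R a, a)` of the block matrix `[[I, R], [0, I]]` on pairs of forms. -/
def shear (R : V → E →L[ℝ] F) (hR : ContDiffOn ℝ ∞ R M) (i : ℕ) :
    (Form M F i × Form M E i) ≃ₗ[ℝ] (Form M F i × Form M E i) where
  toFun z := (z.1 + applyHom R hR i z.2, z.2)
  invFun z := (z.1 - applyHom R hR i z.2, z.2)
  map_add' y z := by simp [add_add_add_comm]
  map_smul' c z := by simp
  left_inv z := by simp
  right_inv z := by simp

theorem joined_shear (hR : ContDiffOn ℝ ∞ R M) (z : Form M F i × Form M E i) (x : V) :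
    joined (shear R hR i z) x =
      (unipotent R x : F × E →L[ℝ] F × E).compContinuousAlternatingMap (joined z x) := by
  ext v <;> simp [joined, shear, applyHom, unipotent_apply]

theorem joined_shear_symm (hR : ContDiffOn ℝ ∞ R M) (z : Form M F i × Form M E i) (x : V) :
    joined ((shear R hR i).symm z) x =
      (unipotent (-R) x : F × E →L[ℝ] F × E).compContinuousAlternatingMap (joined z x) := by
  obtain ⟨y, rfl⟩ := (shear R hR i).surjective z
  rw [LinearEquiv.symm_apply_apply, joined_shear, ← unipotent_symm]
  ext v <;> simp

theorem coneD_shear {S T : V →L[ℝ] E →L[ℝ] F} (hR : ContDiffOn ℝ ∞ R M)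
    (hST : ∀ x ∈ M, fderiv ℝ R x = S - T) (z : Form M F i × Form M E i) :
    coneD M T i (shear R hR i z) = shear R hR (i + 1) (coneD M S i z) := by
  refine joined_ext_on fun x hx => ?_
  have hRx : HasFDerivAt R (S - T) x :=
    hST x hx ▸ ((hR.contDiffAt (M.isOpen.mem_nhds hx)).differentiableAt (by simp)).hasFDerivAt
  rw [joined_coneD T _ hx, joined_shear, joined_coneD S z hx, funext (joined_shear hR z)]
  refine covExtDeriv_gaugeTransform (hasFDerivAt_unipotent hRx).differentiableAt
    (differentiableAt_joined z hx) fun v => ?_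
  rw [gaugeTransform_unipotent_connectionForm S hRx, sub_sub_cancel]

theorem cone_d (M : TopologicalSpace.Opens V) (S : V →L[ℝ] E →L[ℝ] F) (i : ℕ) :
    (cone M S).d i (i + 1) = ModuleCat.ofHom (coneD M S i) :=
  CochainComplex.of_d (fun i => ModuleCat.of ℝ (Form M F i × Form M E i))
    (fun i => ModuleCat.ofHom (coneD M S i)) i

/-- The isomorphism of mapping cones `Z_S ≅ Z_T`, `u ↦ [[I, R], [0, I]] u`, given by a primitive `R`
of `S - T` on `M`. -/
def coneIso {S T : V →L[ℝ] E →L[ℝ] F} (hR : ContDiffOn ℝ ∞ R M)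
    (hST : ∀ x ∈ M, fderiv ℝ R x = S - T) : cone M S ≅ cone M T :=
  HomologicalComplex.Hom.isoOfComponents (fun i => (shear R hR i).toModuleIso) fun i j hij => by
    obtain rfl : i + 1 = j := hij
    rw [cone_d, cone_d]
    ext1
    exact LinearMap.ext (coneD_shear hR hST)

end ConeIsomorphism

section InducedMap

theorem inducedOnCohomology_eq_zero {K L : CochainComplex (ModuleCat.{u} ℝ) ℕ}
    (f : ∀ i, K.X i ⟶ L.X (i + 1))
    (hf : ∀ i, f i ≫ L.d (i + 1) (i + 2) = -(K.d i (i + 1) ≫ f (i + 1))) {i : ℕ}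
    (p : K.X i ⟶ L.X i) (q : K.X (i + 1) ⟶ L.X (i + 1))
    (hpq : p ≫ L.d i (i + 1) = f i + K.d i (i + 1) ≫ q) :
    inducedOnCohomology f hf i = 0 := by
  have hboundary : K.iCycles i ≫ f i = (K.iCycles i ≫ p) ≫ L.d i (i + 1) := by
    rw [Category.assoc, hpq, Preadditive.comp_add, HomologicalComplex.iCycles_d_assoc,
      Limits.zero_comp, add_zero]
  rw [← cancel_epi (K.homologyπ i), Limits.comp_zero]
  exact (ShortComplex.π_descHomology _ _ _).trans
    (L.liftCycles_homologyπ_eq_zero_of_boundary _ _ _ _ hboundary)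

variable {V E F : Type u}
  [NormedAddCommGroup V] [NormedSpace ℝ V] [NormedAddCommGroup E] [NormedSpace ℝ E]
  [NormedAddCommGroup F] [NormedSpace ℝ F] {M : TopologicalSpace.Opens V}

theorem cohomologyS_eq_zero {R : V → E →L[ℝ] F} {S : V →L[ℝ] E →L[ℝ] F}
    (hR : ContDiffOn ℝ ∞ R M) (hS : ∀ x ∈ M, fderiv ℝ R x = S) (i : ℕ) :
    cohomologyS M S i = 0 := by
  refine inducedOnCohomology_eq_zero _ _ (ModuleCat.ofHom (applyHom R hR i))
    (ModuleCat.ofHom (applyHom R hR (i + 1))) ?_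
  rw [deRham_d, deRham_d]
  ext1
  exact LinearMap.ext (extD_applyHom hR hS)

end InducedMap

end TwistedDeRham

end

open TwistedDeRham CategoryTheory in
theorem mainTheorem5 {V E F : Type u}
    [NormedAddCommGroup V] [NormedSpace ℝ V] [NormedAddCommGroup E] [NormedSpace ℝ E]
    [NormedAddCommGroup F] [NormedSpace ℝ F]
    (M : TopologicalSpace.Opens V) (S : V →L[ℝ] E →L[ℝ] F)
    (R : V → E →L[ℝ] F) (hR : R = contract (fun _ => S) (fun x => x)) :
    -- `DR = S`
    (∀ x, HasFDerivAt R S x) ∧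
    -- the differential of the cone is the covariant exterior derivative of `[[0, S], [0, 0]]`
    (∀ (i : ℕ) (z : Form M F i × Form M E i), ∀ x ∈ M,
      joined (coneD M S i z) x = covExtDeriv (connectionForm S) (joined z) x) ∧
    -- the gauge transformation by `[[I, -R], [0, I]]` maps the trivial connection to that of `S`
    (∀ x v, gaugeTransform (unipotent (-R)) 0 x v = connectionForm S x v) ∧
    -- it is an isomorphism of complexes `Z_0 ≅ Z_S`, whose inverse is `[[I, R], [0, I]]`
    (∃ Φ : cone M (0 : V →L[ℝ] E →L[ℝ] F) ≅ cone M S,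
      (∀ (i : ℕ) (z : Form M F i × Form M E i), ∀ x ∈ M,
        joined (M := M) ((Φ.hom.f i).hom z) x =
          (unipotent (-R) x : F × E →L[ℝ] F × E).compContinuousAlternatingMap (joined z x)) ∧
      (∀ (i : ℕ) (z : Form M F i × Form M E i), ∀ x ∈ M,
        joined (M := M) ((Φ.inv.f i).hom z) x =
          (unipotent R x : F × E →L[ℝ] F × E).compContinuousAlternatingMap (joined z x)) ∧
      ∀ i : ℕ, IsIso (HomologicalComplex.homologyMap Φ.hom i)) ∧
    -- `S` induces the zero map on cohomology
    (∀ i : ℕ, cohomologyS M S i = 0) := by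
  have hDR : ∀ x, HasFDerivAt R S x := fun x => by subst hR; exact S.hasFDerivAt
  have hsmooth : ContDiffOn ℝ ∞ R M := by subst hR; exact S.contDiff.contDiffOn
  have hnegR : ContDiffOn ℝ ∞ (-R) M := hsmooth.neg
  have hDnegR : ∀ x, HasFDerivAt (-R) (0 - S) x := fun x => zero_sub S ▸ (hDR x).neg
  refine ⟨hDR, fun i z x hx => joined_coneD S z hx, fun x v => ?gauge,
    ⟨coneIso hnegR fun x _ => (hDnegR x).fderiv, fun i z x _ => joined_shear hnegR z x,
      fun i z x _ => ?inverse, fun i => inferInstance⟩,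
    cohomologyS_eq_zero hsmooth fun x _ => (hDR x).fderiv⟩
  case gauge =>
    rw [← connectionForm_zero, gaugeTransform_unipotent_connectionForm 0 (hDnegR x), sub_sub_cancel]
  case inverse => exact (joined_shear_symm hnegR z x).trans (by rw [neg_neg])
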